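/- **Theorem 3.1 (autoencoders/PCA do not recover the core features).** For $1\le r<d$ let $\mathbb O_{d,r}=\{U\in\mathbb R^{d\times r}:U^\top U=I_r\}$. For $U_1,U_2\in\mathbb O_{d,r}$ let $\|\sin\Theta(U_1,U_2)\|_F=\|U_{1\perp}^\top U_2\|_F$, where the columns of $U_{1\perp}$ form an orthonormal basis of the orthogonal complement of the column space of $U_1$, and let $I(U)=\max_{i\le d}\|e_i^\top U\|^2$. *Model.* Let $U^\star\in\mathbb O_{d,r}$, $\nu>0$, $\sigma_1,\dots,\sigma_d>0$, write $\sigma_{(j)}^2$ for the $j$-th largest of $\sigma_1^2,\dots,\sigma_d^2$, and let $\rho=\nu/\sigma_{(1)}$. The samples are $x_k=U^\star z_k+\xi_k$, $k=1,\dots,n$, where the pairs $(z_k,\xi_k)\in\mathbb R^r\times\mathbb R^d$ are i.i.d., $z_k$ and $\xi_k$ are independent and have mean zero, $\mathrm{Cov}(z_k)=\nu^2I_r$, $\mathrm{Cov}(\xi_k)=\mathrm{diag}(\sigma_1^2,\dots,\sigma_d^2)$, and both are sub-Gaussian with a constant $K$, that is, $\mathbb E e^{\langle a,z_k\rangle}\le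 e^{K\nu^2\|a\|^2/2}$ for all $a\in\mathbb R^r$ and $\mathbb E e^{\langle a,\xi_k\rangle}\le e^{K\sigma_{(1)}^2\|a\|^2/2}$ for all $a\in\mathbb R^d$. *Autoencoder.* With $X=[x_1,\dots,x_n]\in\mathbb R^{d\times n}$, the learned representation is $W_{\mathrm{AE}}=(U_{\mathrm{AE}}\Sigma_{\mathrm{AE}}V_{\mathrm{AE}}^\top)^\top$, where the columns of $U_{\mathrm{AE}}\in\mathbb O_{d,r}$ are eigenvectors of $X(I_n-\frac1n 1_n1_n^\top)X^\top$ for its $r$ largest eigenvalues (any measurable choice), $\Sigma_{\mathrm{AE}}$ is the diagonal matrix of these eigenvalues, and $V_{\mathrm{AE}}$ is any orthogonal $r\times r$ matrix. *Claim.* For all constants $C,C_\sigma,C_I$ and $K\ge0$ there are constants $C_\rho>0$, $c\in(0,1)$ and $D_0>0$, depending only on $C,C_\sigma,C_I,K$, such that the following holds for all $r,d,n$ with $1\le r<d<n$ and $d\ge D_0\,r\log d$, and all models as above. If $\sigma_1^2,\dots,\sigma_d^2$ are pairwise different and $$\frac{\sigma_{(1)}^2}{\sigma_{(d)}^2}<C,\qquad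 I(U^\star)\le C_I\,\frac{r\log d}{d},\qquad \frac{\sigma_{(1)}^2}{\sigma_{(r)}^2-\sigma_{(r+1)}^2}<C_\sigma,\qquad \rho<C_\rho,$$ then $$\mathbb E\,\|\sin\Theta(U^\star,U_{\mathrm{AE}})\|_F\ \ge\ c\sqrt r .$$ -/

import Mathlib

open MeasureTheory ProbabilityTheory
open scoped Matrix NNReal

namespace SpikedPCA

noncomputable section

/-- The values of `f` in decreasing order, with multiplicity: `sortedDesc f j` is the `(j+1)`-th
largest of `f 0, …, f (d-1)`. -/
def sortedDesc {d : ℕ} (f : Fin d → ℝ) (j : Fin d) : ℝ :=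
  f (Tuple.sort f j.rev)

theorem sortedDesc_antitone {d : ℕ} (f : Fin d → ℝ) : Antitone (sortedDesc f) :=
  fun _ _ h => Tuple.monotone_sort f (Fin.rev_le_rev.mpr h)

/-- The Frobenius norm of a real matrix. -/
def frobNorm {m k : Type*} [Fintype m] [Fintype k] (A : Matrix m k ℝ) : ℝ :=
  Real.sqrt (∑ i, ∑ j, A i j ^ 2)

theorem frobNorm_eq_trace {m k : Type*} [Fintype m] [Fintype k] (A : Matrix m k ℝ) :
    frobNorm A = Real.sqrt (Aᵀ * A).trace := by
  unfold frobNorm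
  rw [Finset.sum_comm]
  simp [Matrix.trace, Matrix.mul_apply, pow_two]

/-- The set of `d × r` real matrices with orthonormal columns. -/
def Orthonormals (d r : ℕ) : Set (Matrix (Fin d) (Fin r) ℝ) :=
  {U | Uᵀ * U = 1}

/-- The sine distance between the column spaces of two matrices with orthonormal columns, that is
the Frobenius norm of the part of `U₂` orthogonal to the column space of `U₁`. The lemma
`sinTheta_eq` shows that it is the Frobenius norm of `U₁⊥ᵀ U₂` for each orthonormal
completion `U₁⊥` of `U₁`. -/
def sinTheta {d r : ℕ} (U₁ U₂ : Matrix (Fin d) (Fin r) ℝ) : ℝ :=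
  frobNorm ((1 - U₁ * U₁ᵀ) * U₂)

theorem sinTheta_eq {d r s : ℕ} (U₁ U₂ : Matrix (Fin d) (Fin r) ℝ) (P : Matrix (Fin d) (Fin s) ℝ)
    (hP : Pᵀ * P = 1) (hUP : U₁ * U₁ᵀ + P * Pᵀ = 1) :
    sinTheta U₁ U₂ = frobNorm (Pᵀ * U₂) := by
  have h : 1 - U₁ * U₁ᵀ = P * Pᵀ := by rw [← hUP]; abel
  rw [sinTheta, h, frobNorm_eq_trace, frobNorm_eq_trace]
  congr 2
  simp only [Matrix.transpose_mul, Matrix.transpose_transpose, Matrix.mul_assoc]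
  rw [← Matrix.mul_assoc Pᵀ P, hP, Matrix.one_mul]

/-- The incoherence constant: the largest squared norm of a row. -/
def incoherence {d r : ℕ} (U : Matrix (Fin d) (Fin r) ℝ) : ℝ :=
  ⨆ i, ∑ j, U i j ^ 2

/-- `Y` is a sub-Gaussian random vector with variance proxy `s`: for every vector `a`, the real
random variable `⟨a, Y⟩` is sub-Gaussian with variance proxy `s ‖a‖²`. -/
def IsSubGaussianVector {Ω : Type*} [MeasurableSpace Ω] {m : ℕ} (Y : Ω → Fin m → ℝ) (s : ℝ≥0)
    (μ : Measure Ω) : Prop :=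
  ∀ a : Fin m → ℝ, HasSubgaussianMGF (fun ω => a ⬝ᵥ Y ω) (s * Real.toNNReal (a ⬝ᵥ a)) μ

/-- The covariance matrix of a random vector. -/
def covMatrix {Ω : Type*} [MeasurableSpace Ω] {m : ℕ} (Y : Ω → Fin m → ℝ) (μ : Measure Ω) :
    Matrix (Fin m) (Fin m) ℝ :=
  Matrix.of fun i j => covariance (fun ω => Y ω i) (fun ω => Y ω j) μ

/-- `σ²₍₁₎`, the largest noise variance. -/
def maxVar {d : ℕ} (hd : 0 < d) (σ : Fin d → ℝ) : ℝ :=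
  sortedDesc (fun i => σ i ^ 2) ⟨0, hd⟩

/-- The signal-to-noise ratio `ρ = ν / σ₍₁₎`. -/
def snr {d : ℕ} (hd : 0 < d) (ν : ℝ) (σ : Fin d → ℝ) : ℝ :=
  ν / Real.sqrt (maxVar hd σ)

/-- `n` i.i.d. draws `(z k, ξ k)` of the core feature coordinates and the noise in the spiked
covariance model: `z k` and `ξ k` are independent, centered and sub-Gaussian (with variance proxy
at most `K` times the largest variance), with covariance matrices `ν² I` and
`diag (σ₁², …, σ_d²)`. -/
structure IsSpikedSample {Ω : Type*} [MeasurableSpace Ω] (μ : Measure Ω) {r d n : ℕ} (hd : 0 < d)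
    (ν : ℝ) (σ : Fin d → ℝ) (K : ℝ≥0) (z : Fin n → Ω → Fin r → ℝ) (ξ : Fin n → Ω → Fin d → ℝ) :
    Prop where
  iIndep : iIndepFun (fun k ω => (z k ω, ξ k ω)) μ
  ident : ∀ k l, IdentDistrib (fun ω => (z k ω, ξ k ω)) (fun ω => (z l ω, ξ l ω)) μ μ
  indep : ∀ k, IndepFun (z k) (ξ k) μ
  mean_z : ∀ k i, ∫ ω, z k ω i ∂μ = 0
  mean_noise : ∀ k i, ∫ ω, ξ k ω i ∂μ = 0
  cov_z : ∀ k, covMatrix (z k) μ = ν ^ 2 • (1 : Matrix (Fin r) (Fin r) ℝ)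
  cov_noise : ∀ k, covMatrix (ξ k) μ = Matrix.diagonal fun i => σ i ^ 2
  subG_z : ∀ k, IsSubGaussianVector (z k) (K * Real.toNNReal (ν ^ 2)) μ
  subG_noise : ∀ k, IsSubGaussianVector (ξ k) (K * Real.toNNReal (maxVar hd σ)) μ

/-- The data matrix `X = [x₁, …, xₙ]` with columns `x k = U z k + ξ k`. -/
def dataMatrix {r d n : ℕ} (U : Matrix (Fin d) (Fin r) ℝ) (z : Fin n → Fin r → ℝ)
    (ξ : Fin n → Fin d → ℝ) : Matrix (Fin d) (Fin n) ℝ :=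
  Matrix.of fun i k => (U *ᵥ z k + ξ k) i

/-- The centered scatter matrix `X (I - 1 1ᵀ / n) Xᵀ`. -/
def scatter {d n : ℕ} (X : Matrix (Fin d) (Fin n) ℝ) : Matrix (Fin d) (Fin d) ℝ :=
  X * ((1 : Matrix (Fin n) (Fin n) ℝ) - (1 / (n : ℝ)) • Matrix.of fun _ _ => (1 : ℝ)) * Xᵀ

theorem scatter_isHermitian {d n : ℕ} (X : Matrix (Fin d) (Fin n) ℝ) :
    (scatter X).IsHermitian := by
  have h : (1 - (1 / (n : ℝ)) • Matrix.of fun _ _ => (1 : ℝ) : Matrix (Fin n) (Fin n) ℝ)ᵀ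
      = 1 - (1 / (n : ℝ)) • Matrix.of fun _ _ => (1 : ℝ) := by
    ext i j
    simp [Matrix.one_apply, eq_comm]
  rw [Matrix.IsHermitian, Matrix.conjTranspose_eq_transpose_of_trivial, scatter,
    Matrix.transpose_mul, Matrix.transpose_mul, Matrix.transpose_transpose, h, Matrix.mul_assoc]

/-- The columns of `U` are orthonormal eigenvectors of the symmetric matrix `M` for its `r` largest
eigenvalues (with multiplicity), in decreasing order. -/
structure IsTopEigenvectors {d r : ℕ} (hrd : r ≤ d) {M : Matrix (Fin d) (Fin d) ℝ}
    (hM : M.IsHermitian) (U : Matrix (Fin d) (Fin r) ℝ) : Prop where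
  orthonormal : U ∈ Orthonormals d r
  eigen : ∀ j : Fin r, M *ᵥ U.col j = sortedDesc hM.eigenvalues (Fin.castLE hrd j) • U.col j

/-- `W = (U S Vᵀ)ᵀ` is a representation learned by the linear autoencoder from the data `X`,
together with its singular value decomposition: `U` consists of top-`r` eigenvectors of
`X (I - 1 1ᵀ / n) Xᵀ`, `S` is the diagonal matrix of the `r` largest eigenvalues, and `V` is any
orthogonal matrix. -/
structure IsAutoencoder {r d n : ℕ} (hrd : r ≤ d) (X : Matrix (Fin d) (Fin n) ℝ)
    (W : Matrix (Fin r) (Fin d) ℝ) (U : Matrix (Fin d) (Fin r) ℝ) (S V : Matrix (Fin r) (Fin r) ℝ) :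
    Prop where
  top : IsTopEigenvectors hrd (scatter_isHermitian X) U
  spectral : S = Matrix.diagonal fun j =>
    sortedDesc (scatter_isHermitian X).eigenvalues (Fin.castLE hrd j)
  orthogonal : V ∈ Matrix.orthogonalGroup (Fin r) ℝ
  svd : W = (U * S * Vᵀ)ᵀ

end

end SpikedPCA

open SpikedPCA

open SpikedPCA

/-! The proof compares captured energies. The population covariance is `ν² U⋆U⋆ᵀ + diag σ²`. The `r`
coordinate vectors with the largest noise variances capture at least the sum of these variances. The
subspace `U⋆` is spread out: its squared row norms are at most `1/2` once `D₀` is large. It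
therefore captures at most that sum, minus `r/2` times the gap between the `r`-th and the next
variance, plus the signal `r ν²` (`energy_add_gap_le`). For small `ρ` the signal cannot fill this
deficit, which is of order `r σ²₍₁₎`.

PCA maximizes the empirical energy, so it captures at least as much as those coordinate vectors (Ky
Fan, `sum_diag_le_sum_eigenvalues`). Energy is also stable: subspaces at sine distance `s` have
energies differing by at most `3 √r ℓ² s`, where `ℓ` bounds the operator norm of the data
(`frobNorm_sq_le_add_sinTheta`). Hence `U_AE` cannot be close to `U⋆`.

The comparison is made in expectation, where the energies of fixed vectors are exact, so no
concentration of the sample covariance is needed. The only probabilistic estimate is `E ℓ⁴ =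
O((σ²₍₁₎ n)²)`, from nets and exponential moments (`exists_opNorm_pow_four_le`); it uses `d < n`. A
weighted AM-GM inequality separates `ℓ` from `s` (`energy_deficit_le`). -/

namespace SpikedPCA

/-! ### Sums of largest values and the Ky Fan inequality -/

/-- A weighted sum of `f` with weights in `[0, ε]` of total mass `r` falls short of the sum of the
`r` largest values by at least `(1 - ε) r` times the gap between the `r`-th and the next value. -/
theorem sum_mul_add_gap_le_sum_sortedDesc {d r : ℕ} (hr : 0 < r) (hrd : r < d) (hr' : r - 1 < d)
    (f w : Fin d → ℝ) {ε : ℝ} (hε : ε ≤ 1) (h0 : ∀ i, 0 ≤ w i) (h1 : ∀ i, w i ≤ ε)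
    (hs : ∑ i, w i = r) :
    ∑ i, w i * f i + (1 - ε) * (r * (sortedDesc f ⟨r - 1, hr'⟩ - sortedDesc f ⟨r, hrd⟩))
      ≤ ∑ j : Fin r, sortedDesc f (Fin.castLE hrd.le j) := by
  set g := sortedDesc f with hg
  set t := g ⟨r, hrd⟩ with ht
  set δ := g ⟨r - 1, hr'⟩ - t with hδ
  let e : Fin d ≃ Fin d := Fin.revPerm.trans (Tuple.sort f)
  have he : ∀ j, f (e j) = g j := fun j => rfl
  have hg_anti : Antitone g := sortedDesc_antitone f
  have hδ0 : 0 ≤ δ := sub_nonneg.2 (hg_anti (Fin.mk_le_mk.2 (Nat.sub_le r 1)))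
  -- Subtracting the threshold `t` costs only `r t`, as the weights have total mass `r`. In sorted
  -- order the comparison is then termwise: the first `r` terms are at most `ε (g j - t)`, with `g j
  -- - t ≥ δ`, and the others are nonpositive.
  have key : ∑ i, w i * (f i - t) ≤ ∑ j : Fin r, (g (Fin.castLE hrd.le j) - t - (1 - ε) * δ) := by
    rw [← Equiv.sum_comp e]
    have hmap : ∑ j : Fin r, (g (Fin.castLE hrd.le j) - t - (1 - ε) * δ)
        = ∑ j : Fin d, if (j : ℕ) < r then g j - t - (1 - ε) * δ else 0 := by
      rw [← Finset.sum_filter]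
      have : (Finset.univ.filter fun j : Fin d => (j : ℕ) < r)
          = Finset.univ.map (Fin.castLEEmb hrd.le) := by
        ext j
        simp only [Finset.mem_filter, Finset.mem_univ, true_and, Finset.mem_map]
        exact ⟨fun h => ⟨⟨j, h⟩, rfl⟩, by rintro ⟨i, rfl⟩; exact i.2⟩
      rw [this, Finset.sum_map]
      rfl
    rw [hmap]
    refine Finset.sum_le_sum fun j _ => ?_
    rw [he]
    split_ifs with hj
    · have : δ ≤ g j - t := sub_le_sub_right (hg_anti (Fin.mk_le_mk.2 (by omega))) _
      nlinarith [h1 (e j), mul_le_mul_of_nonneg_right (h1 (e j)) (hδ0.trans this),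
        mul_le_mul_of_nonneg_left this (sub_nonneg.2 hε)]
    · have : g j ≤ t := hg_anti (Fin.mk_le_mk.2 (by omega))
      exact mul_nonpos_of_nonneg_of_nonpos (h0 _) (sub_nonpos.2 this)
  simp only [mul_sub, Finset.sum_sub_distrib, ← Finset.sum_mul, hs, Finset.sum_const,
    Finset.card_univ, Fintype.card_fin, nsmul_eq_mul] at key
  linarith

theorem sum_sq_eq_one_of_transpose_mul {m k : Type*} [Fintype m] [DecidableEq k]
    {U : Matrix m k ℝ} (hU : Uᵀ * U = 1) (j : k) : ∑ i, U i j ^ 2 = 1 := by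
  have := congrFun (congrFun hU j) j
  simpa [Matrix.mul_apply, pow_two] using this

theorem diag_eq_sum_eigenvalues {d : ℕ} {M : Matrix (Fin d) (Fin d) ℝ} (hM : M.IsHermitian)
    (i : Fin d) :
    M i i = ∑ k, (hM.eigenvectorUnitary : Matrix (Fin d) (Fin d) ℝ) i k ^ 2 * hM.eigenvalues k := by
  have h := congrFun (congrFun hM.spectral_theorem i) i
  rw [Unitary.conjStarAlgAut_apply] at h
  rw [h, Matrix.mul_apply]
  refine Finset.sum_congr rfl fun k _ => ?_
  rw [Matrix.mul_diagonal]
  simp [Matrix.star_apply]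
  ring_nf

/-- The sum of `r` diagonal entries of a symmetric matrix is at most the sum of its `r` largest
eigenvalues. -/
theorem sum_diag_le_sum_eigenvalues {d r : ℕ} (hr : 0 < r) (hrd : r < d)
    {M : Matrix (Fin d) (Fin d) ℝ} (hM : M.IsHermitian) (T : Fin r → Fin d)
    (hT : Function.Injective T) :
    ∑ j, M (T j) (T j) ≤ ∑ j : Fin r, sortedDesc hM.eigenvalues (Fin.castLE hrd.le j) := by
  obtain ⟨V, hV⟩ : ∃ V : Matrix (Fin d) (Fin d) ℝ, V = hM.eigenvectorUnitary := ⟨_, rfl⟩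
  have hVV : Vᵀ * V = 1 := by
    simpa [hV, Matrix.star_eq_conjTranspose] using Unitary.coe_star_mul_self hM.eigenvectorUnitary
  have hVV' : Vᵀᵀ * Vᵀ = 1 := by
    simpa [hV, Matrix.star_eq_conjTranspose] using Unitary.coe_mul_star_self hM.eigenvectorUnitary
  -- Each weight is part of the squared norm of a column of `V`, hence at most `1`. With `ε = 1` the
  -- gap term vanishes.
  have h := sum_mul_add_gap_le_sum_sortedDesc hr hrd (by omega) hM.eigenvalues
    (fun k => ∑ j, V (T j) k ^ 2) le_rfl (fun k => Finset.sum_nonneg fun j _ => sq_nonneg _)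
    (fun k => by
      rw [← sum_sq_eq_one_of_transpose_mul hVV k]
      refine (Finset.sum_map Finset.univ ⟨T, hT⟩ fun i => V i k ^ 2).ge.trans ?_
      exact Finset.sum_le_sum_of_subset_of_nonneg (Finset.subset_univ _)
        fun _ _ _ => sq_nonneg _)
    (by
      rw [Finset.sum_comm]
      have : ∀ i, ∑ k, V i k ^ 2 = 1 := fun i => sum_sq_eq_one_of_transpose_mul hVV' i
      simp [this])
  rw [sub_self, zero_mul, add_zero] at h
  refine le_of_eq_of_le ?_ h
  simp only [diag_eq_sum_eigenvalues hM, Finset.sum_mul, ← hV]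
  rw [Finset.sum_comm]

/-- The eigenvector equation enters the argument only here, to turn the top eigenvalues into the
energy captured by `U`. -/
theorem IsTopEigenvectors.sum_eigenvalues_eq_trace {d r : ℕ} {hrd : r ≤ d}
    {M : Matrix (Fin d) (Fin d) ℝ} {hM : M.IsHermitian} {U : Matrix (Fin d) (Fin r) ℝ}
    (h : IsTopEigenvectors hrd hM U) :
    ∑ j : Fin r, sortedDesc hM.eigenvalues (Fin.castLE hrd j) = (Uᵀ * M * U).trace := by
  rw [Matrix.trace]
  refine Finset.sum_congr rfl fun j _ => ?_
  have h1 : ∀ i, (M * U) i j = sortedDesc hM.eigenvalues (Fin.castLE hrd j) * U i j := fun i => by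
    simpa [Matrix.mulVec, Matrix.mul_apply, dotProduct] using congrFun (h.eigen j) i
  have h2 : ∑ i, U i j ^ 2 = 1 := sum_sq_eq_one_of_transpose_mul h.orthonormal j
  rw [Matrix.diag_apply, Matrix.mul_assoc, Matrix.mul_apply]
  simp only [h1, Matrix.transpose_apply]
  conv_lhs => rw [← mul_one (sortedDesc _ _), ← h2, Finset.mul_sum]
  exact Finset.sum_congr rfl fun i _ => by ring

/-! ### Frobenius norm and stability of the captured energy -/

section Frobenius

variable {m k l : Type*} [Fintype m] [Fintype k] [Fintype l]

theorem frobNorm_nonneg (A : Matrix m k ℝ) : 0 ≤ frobNorm A := Real.sqrt_nonneg _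

theorem frobNorm_sq (A : Matrix m k ℝ) : frobNorm A ^ 2 = ∑ i, ∑ j, A i j ^ 2 :=
  Real.sq_sqrt (Finset.sum_nonneg fun _ _ => Finset.sum_nonneg fun _ _ => sq_nonneg _)

theorem frobNorm_sq_eq_trace (A : Matrix m k ℝ) : frobNorm A ^ 2 = (Aᵀ * A).trace := by
  rw [frobNorm_sq, Finset.sum_comm]
  simp [Matrix.trace, Matrix.mul_apply, pow_two]

theorem frobNorm_transpose (A : Matrix m k ℝ) : frobNorm Aᵀ = frobNorm A := by
  unfold frobNorm
  rw [Finset.sum_comm]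
  rfl

theorem frobNorm_add_le (A B : Matrix m k ℝ) : frobNorm (A + B) ≤ frobNorm A + frobNorm B := by
  let φ : Matrix m k ℝ → EuclideanSpace ℝ (m × k) := fun A => WithLp.toLp 2 fun p => A p.1 p.2
  have h : ∀ A, frobNorm A = ‖φ A‖ := by
    intro A
    simp [φ, frobNorm, EuclideanSpace.norm_eq, Fintype.sum_prod_type]
  have hadd : φ (A + B) = φ A + φ B := by
    ext p
    simp [φ]
  rw [h, h, h, hadd]
  exact norm_add_le _ _

theorem frobNorm_mul_le_of_mulVec_le {ℓ : ℝ} (hℓ : 0 ≤ ℓ) (A : Matrix m k ℝ)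
    (hA : ∀ v, (A *ᵥ v) ⬝ᵥ (A *ᵥ v) ≤ ℓ ^ 2 * (v ⬝ᵥ v)) (B : Matrix k l ℝ) :
    frobNorm (A * B) ≤ ℓ * frobNorm B := by
  refine abs_le_of_sq_le_sq' ?_ (mul_nonneg hℓ (frobNorm_nonneg B)) |>.2
  rw [mul_pow, frobNorm_sq, frobNorm_sq, Finset.sum_comm, Finset.sum_comm (γ := k),
    Finset.mul_sum]
  refine Finset.sum_le_sum fun j _ => ?_
  have := hA (B.col j)
  simpa [dotProduct, pow_two, Matrix.mul_apply, Matrix.mulVec] using this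

variable [DecidableEq k]

theorem frobNorm_mul_of_transpose_mul {U : Matrix m k ℝ} (hU : Uᵀ * U = 1) (A : Matrix k l ℝ) :
    frobNorm (U * A) = frobNorm A := by
  rw [frobNorm_eq_trace, frobNorm_eq_trace, Matrix.transpose_mul, Matrix.mul_assoc,
    ← Matrix.mul_assoc Uᵀ, hU, Matrix.one_mul]

variable [DecidableEq m]

/-- Pythagoras for the orthogonal projection `U Uᵀ`. -/
theorem frobNorm_sq_add_frobNorm_sq {U : Matrix m k ℝ} (hU : Uᵀ * U = 1) (A : Matrix m l ℝ) :
    frobNorm (Uᵀ * A) ^ 2 + frobNorm ((1 - U * Uᵀ) * A) ^ 2 = frobNorm A ^ 2 := by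
  rw [frobNorm_sq_eq_trace, frobNorm_sq_eq_trace, frobNorm_sq_eq_trace, ← Matrix.trace_add]
  congr 1
  have h : (1 - U * Uᵀ) * (1 - U * Uᵀ) = 1 - U * Uᵀ := by
    rw [Matrix.mul_sub, Matrix.mul_one, Matrix.sub_mul, Matrix.one_mul, Matrix.mul_assoc,
      ← Matrix.mul_assoc Uᵀ, hU, Matrix.one_mul, sub_self, sub_zero]
  have h' : (1 - U * Uᵀ)ᵀ = 1 - U * Uᵀ := by
    simp [Matrix.transpose_sub, Matrix.transpose_mul]
  rw [Matrix.transpose_mul, Matrix.transpose_mul, h', Matrix.mul_assoc Aᵀ (1 - U * Uᵀ),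
    ← Matrix.mul_assoc (1 - U * Uᵀ), h, Matrix.transpose_transpose, Matrix.mul_assoc Aᵀ,
    ← Matrix.mul_add, ← Matrix.mul_assoc U, ← Matrix.add_mul, add_sub_cancel, Matrix.one_mul]

theorem frobNorm_transpose_mul_le {U : Matrix m k ℝ} (hU : Uᵀ * U = 1) (A : Matrix m l ℝ) :
    frobNorm (Uᵀ * A) ≤ frobNorm A := by
  have := frobNorm_sq_add_frobNorm_sq hU A
  exact abs_le_of_sq_le_sq' (by nlinarith [sq_nonneg (frobNorm ((1 - U * Uᵀ) * A))])
    (frobNorm_nonneg A) |>.2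

theorem frobNorm_one_sub_mul_le {U : Matrix m k ℝ} (hU : Uᵀ * U = 1) (A : Matrix m l ℝ) :
    frobNorm ((1 - U * Uᵀ) * A) ≤ frobNorm A := by
  have := frobNorm_sq_add_frobNorm_sq hU A
  exact abs_le_of_sq_le_sq' (by nlinarith [sq_nonneg (frobNorm (Uᵀ * A))])
    (frobNorm_nonneg A) |>.2

end Frobenius

theorem frobNorm_of_mem_orthonormals {d r : ℕ} {U : Matrix (Fin d) (Fin r) ℝ}
    (hU : U ∈ Orthonormals d r) : frobNorm U = Real.sqrt r := by
  have : Uᵀ * U = 1 := hU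
  simp [frobNorm_eq_trace, this]

theorem sinTheta_nonneg {d r : ℕ} (U₁ U₂ : Matrix (Fin d) (Fin r) ℝ) : 0 ≤ sinTheta U₁ U₂ :=
  frobNorm_nonneg _

theorem sinTheta_le {d r : ℕ} {U₁ U₂ : Matrix (Fin d) (Fin r) ℝ} (h₁ : U₁ ∈ Orthonormals d r)
    (h₂ : U₂ ∈ Orthonormals d r) : sinTheta U₁ U₂ ≤ Real.sqrt r := by
  rw [← frobNorm_of_mem_orthonormals h₂]
  exact frobNorm_one_sub_mul_le h₁ U₂

/-- The captured energy `‖Uᵀ Y‖²` varies at most linearly with the sine distance. -/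
theorem frobNorm_sq_le_add_sinTheta {d r p : ℕ} {U₁ U₂ : Matrix (Fin d) (Fin r) ℝ}
    (h₁ : U₁ ∈ Orthonormals d r) (h₂ : U₂ ∈ Orthonormals d r) (Y : Matrix (Fin d) (Fin p) ℝ)
    {ℓ : ℝ} (hℓ : 0 ≤ ℓ) (hY : ∀ v, (Yᵀ *ᵥ v) ⬝ᵥ (Yᵀ *ᵥ v) ≤ ℓ ^ 2 * (v ⬝ᵥ v)) :
    frobNorm (U₂ᵀ * Y) ^ 2
      ≤ frobNorm (U₁ᵀ * Y) ^ 2 + 3 * Real.sqrt r * (ℓ ^ 2 * sinTheta U₁ U₂) := by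
  set s := sinTheta U₁ U₂ with hs
  set α := frobNorm (U₁ᵀ * Y) with hα
  have hs0 : 0 ≤ s := sinTheta_nonneg _ _
  have hsr : s ≤ Real.sqrt r := sinTheta_le h₁ h₂
  have hα0 : 0 ≤ α := frobNorm_nonneg _
  have hαr : α ≤ ℓ * Real.sqrt r := by
    rw [hα, ← frobNorm_transpose, Matrix.transpose_mul, Matrix.transpose_transpose,
      ← frobNorm_of_mem_orthonormals h₁]
    exact frobNorm_mul_le_of_mulVec_le hℓ _ hY _
  have hsplit : Yᵀ * U₂ = (U₂ᵀ * (U₁ * (U₁ᵀ * Y)))ᵀ + Yᵀ * ((1 - U₁ * U₁ᵀ) * U₂) := by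
    simp only [Matrix.transpose_mul, Matrix.transpose_transpose, Matrix.sub_mul, Matrix.mul_sub,
      Matrix.one_mul, Matrix.mul_assoc]
    abel
  have hle : frobNorm (U₂ᵀ * Y) ≤ α + ℓ * s := by
    rw [← frobNorm_transpose, Matrix.transpose_mul, Matrix.transpose_transpose, hsplit]
    refine (frobNorm_add_le _ _).trans (add_le_add ?_ (frobNorm_mul_le_of_mulVec_le hℓ _ hY _))
    rw [frobNorm_transpose, hα, ← frobNorm_mul_of_transpose_mul h₁ (U₁ᵀ * Y)]
    exact frobNorm_transpose_mul_le h₂ _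
  have h0 : 0 ≤ frobNorm (U₂ᵀ * Y) := frobNorm_nonneg _
  -- The factor `3`: the cross term `2 α ℓ s` is at most `2 √r ℓ² s` because `α ≤ ℓ √r`, and `ℓ² s²`
  -- is at most `√r ℓ² s` because `s ≤ √r`.
  have h2 : frobNorm (U₂ᵀ * Y) ^ 2 ≤ (α + ℓ * s) ^ 2 := pow_le_pow_left₀ h0 hle 2
  have h3 : α * (ℓ * s) ≤ ℓ * Real.sqrt r * (ℓ * s) :=
    mul_le_mul_of_nonneg_right hαr (mul_nonneg hℓ hs0)
  have h4 : ℓ ^ 2 * s * s ≤ ℓ ^ 2 * s * Real.sqrt r :=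
    mul_le_mul_of_nonneg_left hsr (mul_nonneg (sq_nonneg _) hs0)
  nlinarith

/-! ### Nets and the operator norm -/

/-- The ball of radius `2` has a `1`-net with at most `5 ^ dim` points. -/
theorem exists_net_card_le (E : Type*) [NormedAddCommGroup E] [NormedSpace ℝ E]
    [FiniteDimensional ℝ E] :
    ∃ N : Finset E, N.card ≤ 5 ^ Module.finrank ℝ E ∧ (∀ a ∈ N, ‖a‖ ≤ 2) ∧
      ∀ v : E, ‖v‖ ≤ 2 → ∃ a ∈ N, ‖v - a‖ < 1 := by
  classical
  let P : ℕ → Prop := fun k => ∃ s : Finset E, (∀ c ∈ s, ‖c‖ ≤ 2) ∧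
    (∀ c ∈ s, ∀ c' ∈ s, c ≠ c' → 1 ≤ ‖c - c'‖) ∧ s.card = k
  have hP : ∀ k, P k → k ≤ 5 ^ Module.finrank ℝ E := by
    rintro k ⟨s, h1, h2, rfl⟩
    exact Besicovitch.card_le_of_separated s h1 h2
  have h0 : P 0 := ⟨∅, by simp, by simp, rfl⟩
  -- A `1`-separated set of maximal cardinality is a net: a point at distance at least `1` from all
  -- of it could be added.
  obtain ⟨s, h1, h2, h3⟩ : P (Nat.findGreatest P (5 ^ Module.finrank ℝ E)) :=
    Nat.findGreatest_spec (Nat.zero_le _) h0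
  refine ⟨s, hP _ ⟨s, h1, h2, rfl⟩, h1, fun v hv => ?_⟩
  by_contra! hcon
  have hvs : v ∉ s := fun h => by
    have := hcon v h
    simp at this
    linarith
  have hins : P (insert v s).card := by
    refine ⟨insert v s, ?_, ?_, rfl⟩
    · simpa using ⟨hv, h1⟩
    · intro c hc c' hc' hne
      rw [Finset.mem_insert] at hc hc'
      rcases hc with rfl | hc <;> rcases hc' with rfl | hc'
      · exact absurd rfl hne
      · exact hcon _ hc'
      · rw [norm_sub_rev]
        exact hcon _ hc
      · exact h2 _ hc _ hc' hne
  have := Nat.le_findGreatest (hP _ hins) hins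
  rw [Finset.card_insert_of_notMem hvs] at this
  omega

/-- The operator norm is at most the maximum of `⟪b, T a⟫` over nets of the balls of radius `2`. -/
theorem exists_opNorm_le_inner {E F : Type*} [NormedAddCommGroup E] [NormedSpace ℝ E]
    [NormedAddCommGroup F] [InnerProductSpace ℝ F] {N : Finset E} {N' : Finset F}
    (hN : ∀ v : E, ‖v‖ ≤ 2 → ∃ a ∈ N, ‖v - a‖ < 1)
    (hN' : ∀ v : F, ‖v‖ ≤ 2 → ∃ b ∈ N', ‖v - b‖ < 1) (T : E →L[ℝ] F) :
    ∃ a ∈ N, ∃ b ∈ N', ‖T‖ ≤ inner ℝ b (T a) := by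
  obtain ⟨a₀, ha₀, -⟩ := hN 0 (by simp)
  obtain ⟨a, ha, hmax⟩ := N.exists_max_image (fun a => ‖T a‖) ⟨a₀, ha₀⟩
  -- For a unit vector `x`, the point `2x` is within `1` of the net, so `2 ‖T x‖ ≤ ‖T a‖ + ‖T‖`.
  -- Taking the supremum over `x` absorbs `‖T‖`.
  have hTa : ‖T‖ ≤ ‖T a‖ := by
    have : ‖T‖ ≤ (‖T a‖ + ‖T‖) / 2 := by
      refine T.opNorm_le_of_unit_norm (by positivity) fun x hx => ?_
      obtain ⟨c, hc, hxc⟩ := hN ((2 : ℝ) • x) (by simp [norm_smul, hx])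
      have h1 : ‖T ((2 : ℝ) • x)‖ ≤ ‖T c‖ + ‖T ((2 : ℝ) • x - c)‖ := by
        conv_lhs => rw [← add_sub_cancel c ((2 : ℝ) • x), map_add]
        exact norm_add_le _ _
      have h2 : ‖T ((2 : ℝ) • x - c)‖ ≤ ‖T‖ * 1 :=
        (T.le_opNorm _).trans (mul_le_mul_of_nonneg_left hxc.le (norm_nonneg _))
      have h3 := hmax c hc
      rw [map_smul, norm_smul, Real.norm_two] at h1
      linarith
    linarith
  -- The vector of length `2` along `T a` pairs with it to `2 ‖T a‖`, and passing to the net loses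
  -- at most `‖T a‖`. If `T a = 0`, this vector is `0`.
  obtain ⟨b, hb, hyb⟩ := hN' ((2 / ‖T a‖) • T a) (by
    rw [norm_smul, norm_div, norm_norm, Real.norm_two]
    rcases eq_or_ne ‖T a‖ 0 with h | h
    · simp [h]
    · rw [div_mul_cancel₀ _ h])
  refine ⟨a, ha, b, hb, hTa.trans ?_⟩
  have h1 : inner ℝ ((2 / ‖T a‖) • T a) (T a) = 2 * ‖T a‖ := by
    rw [real_inner_smul_left, real_inner_self_eq_norm_sq]
    rcases eq_or_ne ‖T a‖ 0 with h | h
    · simp [h]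
    · field_simp
  have h2 : inner ℝ ((2 / ‖T a‖) • T a - b) (T a) ≤ 1 * ‖T a‖ :=
    (real_inner_le_norm _ _).trans (mul_le_mul_of_nonneg_right hyb.le (norm_nonneg _))
  rw [inner_sub_left, h1] at h2
  linarith

/-- Nets over which the bilinear form of a matrix controls its operator norm. -/
theorem exists_bilinear_nets (d n : ℕ) :
    ∃ (N : Finset (Fin d → ℝ)) (N' : Finset (Fin n → ℝ)), N.card ≤ 5 ^ d ∧ N'.card ≤ 5 ^ n ∧
      (∀ a ∈ N, a ⬝ᵥ a ≤ 4) ∧ (∀ b ∈ N', b ⬝ᵥ b ≤ 4) ∧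
      ∀ X : Matrix (Fin d) (Fin n) ℝ, ∃ ℓ : ℝ, 0 ≤ ℓ ∧
        (∀ v, (Xᵀ *ᵥ v) ⬝ᵥ (Xᵀ *ᵥ v) ≤ ℓ ^ 2 * (v ⬝ᵥ v)) ∧
        ∃ a ∈ N, ∃ b ∈ N', ℓ ≤ b ⬝ᵥ (Xᵀ *ᵥ a) := by
  classical
  have hsq : ∀ {m : ℕ} (v : EuclideanSpace ℝ (Fin m)),
      ‖v‖ ^ 2 = (WithLp.ofLp v) ⬝ᵥ (WithLp.ofLp v) := by
    intro m v
    rw [EuclideanSpace.norm_sq_eq]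
    simp [dotProduct, pow_two]
  obtain ⟨N, hNc, hN2, hN⟩ := exists_net_card_le (EuclideanSpace ℝ (Fin d))
  obtain ⟨N', hNc', hN2', hN'⟩ := exists_net_card_le (EuclideanSpace ℝ (Fin n))
  rw [finrank_euclideanSpace_fin] at hNc hNc'
  refine ⟨N.image WithLp.ofLp, N'.image WithLp.ofLp, Finset.card_image_le.trans hNc,
    Finset.card_image_le.trans hNc', ?_, ?_, fun X => ?_⟩
  · intro a ha
    obtain ⟨a, ha', rfl⟩ := Finset.mem_image.1 ha
    rw [← hsq]
    nlinarith [hN2 a ha', norm_nonneg a]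
  · intro a ha
    obtain ⟨a, ha', rfl⟩ := Finset.mem_image.1 ha
    rw [← hsq]
    nlinarith [hN2' a ha', norm_nonneg a]
  · let T : EuclideanSpace ℝ (Fin d) →L[ℝ] EuclideanSpace ℝ (Fin n) :=
      LinearMap.toContinuousLinearMap (Matrix.toEuclideanLin Xᵀ)
    have hT : ∀ v, WithLp.ofLp (T v) = Xᵀ *ᵥ WithLp.ofLp v := fun v => rfl
    refine ⟨‖T‖, norm_nonneg _, fun v => ?_, ?_⟩
    · have := T.le_opNorm (WithLp.toLp 2 v)
      have h := pow_le_pow_left₀ (norm_nonneg _) this 2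
      rw [mul_pow, hsq, hsq (WithLp.toLp 2 v), hT] at h
      exact h
    · obtain ⟨a, ha, b, hb, h⟩ := exists_opNorm_le_inner hN hN' T
      refine ⟨_, Finset.mem_image_of_mem _ ha, _, Finset.mem_image_of_mem _ hb, ?_⟩
      rw [← hT]
      refine h.trans_eq ?_
      simp [EuclideanSpace.inner_eq_star_dotProduct, dotProduct_comm]

/-! ### The scatter matrix and its energies -/

section Scatter

variable {d n : ℕ}

theorem quadForm_scatter (X : Matrix (Fin d) (Fin n) ℝ) (a : Fin d → ℝ) :
    a ⬝ᵥ (scatter X *ᵥ a) = ∑ k, (Xᵀ *ᵥ a) k ^ 2 - (∑ k, (Xᵀ *ᵥ a) k) ^ 2 / n := by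
  rw [scatter, ← Matrix.mulVec_mulVec, ← Matrix.mulVec_mulVec, Matrix.dotProduct_mulVec,
    ← Matrix.mulVec_transpose]
  generalize Xᵀ *ᵥ a = p
  rw [Matrix.sub_mulVec, Matrix.one_mulVec, dotProduct_sub, Matrix.smul_mulVec, dotProduct_smul]
  have : p ⬝ᵥ ((Matrix.of fun _ _ => (1 : ℝ) : Matrix (Fin n) (Fin n) ℝ) *ᵥ p)
      = (∑ k, p k) ^ 2 := by
    simp [dotProduct, Matrix.mulVec, pow_two, Finset.sum_mul]
  rw [this, dotProduct, smul_eq_mul]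
  simp only [pow_two]
  ring

/-- The centering matrix is symmetric and idempotent, so `Y` is the centered data. This factor makes
energies Frobenius norms. -/
theorem exists_scatter_eq_mul_transpose (hn : n ≠ 0) (X : Matrix (Fin d) (Fin n) ℝ) :
    ∃ Y : Matrix (Fin d) (Fin n) ℝ, scatter X = Y * Yᵀ := by
  set J : Matrix (Fin n) (Fin n) ℝ := Matrix.of fun _ _ => (1 : ℝ) with hJ
  have hn' : (n : ℝ) ≠ 0 := Nat.cast_ne_zero.2 hn
  have hJJ : J * J = (n : ℝ) • J := by
    ext i j
    simp [hJ, Matrix.mul_apply]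
  have hJT : Jᵀ = J := rfl
  have hHT : (1 - (1 / (n : ℝ)) • J)ᵀ = 1 - (1 / (n : ℝ)) • J := by
    rw [Matrix.transpose_sub, Matrix.transpose_smul, hJT, Matrix.transpose_one]
  have hHH : (1 - (1 / (n : ℝ)) • J) * (1 - (1 / (n : ℝ)) • J) = 1 - (1 / (n : ℝ)) • J := by
    rw [Matrix.mul_sub, Matrix.mul_one, Matrix.sub_mul, Matrix.one_mul, Matrix.smul_mul,
      Matrix.mul_smul, hJJ, smul_smul (1 / (n : ℝ)) (n : ℝ), one_div_mul_cancel hn', one_smul,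
      sub_self, sub_zero]
  refine ⟨X * (1 - (1 / (n : ℝ)) • J), ?_⟩
  rw [Matrix.transpose_mul, hHT, Matrix.mul_assoc X, ← Matrix.mul_assoc _ _ Xᵀ, hHH, scatter,
    Matrix.mul_assoc]

theorem trace_transpose_mul_mul {r : ℕ} (M : Matrix (Fin d) (Fin d) ℝ)
    (U : Matrix (Fin d) (Fin r) ℝ) : (Uᵀ * M * U).trace = ∑ j, U.col j ⬝ᵥ (M *ᵥ U.col j) := by
  rw [Matrix.trace]
  refine Finset.sum_congr rfl fun j _ => ?_
  rw [Matrix.diag_apply, Matrix.mul_assoc, Matrix.mul_apply]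
  rfl

/-- If the top eigenvectors of the scatter matrix are close to `U₁`, then `U₁` captures nearly as
much energy as any `r` coordinate vectors. -/
theorem IsTopEigenvectors.sum_diag_scatter_le {r : ℕ} (hr : 0 < r) (hrd : r < d) (hn : n ≠ 0)
    {X : Matrix (Fin d) (Fin n) ℝ} {U₁ U₂ : Matrix (Fin d) (Fin r) ℝ}
    (h₁ : U₁ ∈ Orthonormals d r) (h₂ : IsTopEigenvectors hrd.le (scatter_isHermitian X) U₂)
    (T : Fin r → Fin d) (hT : Function.Injective T) {ℓ : ℝ} (hℓ : 0 ≤ ℓ)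
    (hX : ∀ v, (Xᵀ *ᵥ v) ⬝ᵥ (Xᵀ *ᵥ v) ≤ ℓ ^ 2 * (v ⬝ᵥ v)) :
    ∑ j, scatter X (T j) (T j) ≤ ∑ j, U₁.col j ⬝ᵥ (scatter X *ᵥ U₁.col j)
      + 3 * Real.sqrt r * (ℓ ^ 2 * sinTheta U₁ U₂) := by
  obtain ⟨Y, hY⟩ := exists_scatter_eq_mul_transpose hn X
  have htr : ∀ U : Matrix (Fin d) (Fin r) ℝ,
      (Uᵀ * scatter X * U).trace = frobNorm (Uᵀ * Y) ^ 2 := by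
    intro U
    rw [hY, ← frobNorm_transpose, frobNorm_sq_eq_trace]
    simp only [Matrix.transpose_mul, Matrix.transpose_transpose, Matrix.mul_assoc]
  -- Centering only subtracts a square from the quadratic form, so the bound for `X` passes to `Y`.
  have hYv : ∀ v, (Yᵀ *ᵥ v) ⬝ᵥ (Yᵀ *ᵥ v) ≤ ℓ ^ 2 * (v ⬝ᵥ v) := by
    intro v
    refine le_trans ?_ (hX v)
    have h1 : (Yᵀ *ᵥ v) ⬝ᵥ (Yᵀ *ᵥ v) = v ⬝ᵥ (scatter X *ᵥ v) := by
      rw [hY, ← Matrix.mulVec_mulVec, Matrix.dotProduct_mulVec v, ← Matrix.mulVec_transpose]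
    rw [h1, quadForm_scatter]
    have h2 : (Xᵀ *ᵥ v) ⬝ᵥ (Xᵀ *ᵥ v) = ∑ k, (Xᵀ *ᵥ v) k ^ 2 := by simp [dotProduct, pow_two]
    rw [h2]
    exact sub_le_self _ (by positivity)
  rw [← trace_transpose_mul_mul, htr]
  refine le_trans ?_ (frobNorm_sq_le_add_sinTheta h₁ h₂.orthonormal Y hℓ hYv)
  rw [← htr, ← h₂.sum_eigenvalues_eq_trace]
  exact sum_diag_le_sum_eigenvalues hr hrd _ T hT

end Scatter

/-! ### Sub-Gaussian projections of one sample -/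

theorem hasSubgaussianMGF_mono {Ω : Type*} [MeasurableSpace Ω] {μ : Measure Ω} {X : Ω → ℝ}
    {s s' : ℝ≥0} (h : HasSubgaussianMGF X s μ) (hs : s ≤ s') : HasSubgaussianMGF X s' μ where
  integrable_exp_mul := h.integrable_exp_mul
  mgf_le t := (h.mgf_le t).trans (Real.exp_le_exp.2 (by gcongr))

theorem hasSubgaussianMGF_const_mul {Ω : Type*} [MeasurableSpace Ω] {μ : Measure Ω} {X : Ω → ℝ}
    {s : ℝ≥0} (h : HasSubgaussianMGF X s μ) (a : ℝ) :
    HasSubgaussianMGF (fun ω => a * X ω) (Real.toNNReal (a ^ 2) * s) μ := by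
  rw [Real.toNNReal_of_nonneg (sq_nonneg a)]
  exact h.const_mul a

theorem maxVar_pos {d : ℕ} (hd : 0 < d) {σ : Fin d → ℝ} (hσ : ∀ i, 0 < σ i) : 0 < maxVar hd σ :=
  pow_pos (hσ _) 2

section Sample

variable {Ω : Type*} [MeasurableSpace Ω] {μ : Measure Ω} {r d n : ℕ}
  {hd : 0 < d} {ν : ℝ} {σ : Fin d → ℝ} {K : ℝ≥0} {z : Fin n → Ω → Fin r → ℝ}
  {ξ : Fin n → Ω → Fin d → ℝ}

theorem transpose_dataMatrix_mulVec (U : Matrix (Fin d) (Fin r) ℝ) (z : Fin n → Fin r → ℝ)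
    (ξ : Fin n → Fin d → ℝ) (a : Fin d → ℝ) (k : Fin n) :
    ((dataMatrix U z ξ)ᵀ *ᵥ a) k = (Uᵀ *ᵥ a) ⬝ᵥ z k + a ⬝ᵥ ξ k := by
  have : ((dataMatrix U z ξ)ᵀ *ᵥ a) k = a ⬝ᵥ (U *ᵥ z k + ξ k) := by
    simp [dataMatrix, Matrix.mulVec, dotProduct, mul_comm]
  rw [this, dotProduct_add, Matrix.dotProduct_mulVec, ← Matrix.mulVec_transpose]

theorem memLp_coord {m : ℕ} {Y : Ω → Fin m → ℝ} {s : ℝ≥0} (h : IsSubGaussianVector Y s μ)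
    (i : Fin m) : MemLp (fun ω => Y ω i) 2 μ := by
  have := (h (Pi.single i 1)).memLp 2
  simpa using this

theorem variance_dotProduct [IsFiniteMeasure μ] {m : ℕ} {Y : Ω → Fin m → ℝ} {v : Fin m → ℝ}
    (hY : ∀ i, MemLp (fun ω => Y ω i) 2 μ) (hcov : covMatrix Y μ = Matrix.diagonal v)
    (a : Fin m → ℝ) : variance (fun ω => a ⬝ᵥ Y ω) μ = ∑ i, v i * a i ^ 2 := by
  have hc : ∀ i j, covariance (fun ω => Y ω i) (fun ω => Y ω j) μ = Matrix.diagonal v i j :=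
    fun i j => by rw [← hcov]; rfl
  simp only [dotProduct]
  rw [variance_fun_sum fun i => (hY i).const_mul (a i)]
  refine Finset.sum_congr rfl fun i _ => ?_
  rw [Finset.sum_eq_single i]
  · rw [covariance_const_mul_left, covariance_const_mul_right, hc, Matrix.diagonal_apply_eq]
    ring
  · intro j _ hj
    rw [covariance_const_mul_left, covariance_const_mul_right, hc,
      Matrix.diagonal_apply_ne' _ hj]
    ring
  · simp

namespace IsSpikedSample

theorem subG_projection (h : IsSpikedSample μ hd ν σ K z ξ) (U : Matrix (Fin d) (Fin r) ℝ)
    (a : Fin d → ℝ) (k : Fin n) :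
    HasSubgaussianMGF (fun ω => (Uᵀ *ᵥ a) ⬝ᵥ z k ω + a ⬝ᵥ ξ k ω)
      (K * Real.toNNReal (ν ^ 2) * Real.toNNReal ((Uᵀ *ᵥ a) ⬝ᵥ (Uᵀ *ᵥ a))
        + K * Real.toNNReal (maxVar hd σ) * Real.toNNReal (a ⬝ᵥ a)) μ :=
  (h.subG_z k _).add_of_indepFun (h.subG_noise k a)
    ((h.indep k).comp (φ := fun x => (Uᵀ *ᵥ a) ⬝ᵥ x) (ψ := fun x => a ⬝ᵥ x)
      (by unfold dotProduct; fun_prop) (by unfold dotProduct; fun_prop))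

theorem iIndepFun_projection (h : IsSpikedSample μ hd ν σ K z ξ) (U : Matrix (Fin d) (Fin r) ℝ)
    (a : Fin d → ℝ) :
    iIndepFun (fun k ω => (Uᵀ *ᵥ a) ⬝ᵥ z k ω + a ⬝ᵥ ξ k ω) μ :=
  h.iIndep.comp (fun _ x => (Uᵀ *ᵥ a) ⬝ᵥ x.1 + a ⬝ᵥ x.2)
    (fun _ => by unfold dotProduct; fun_prop)

theorem integral_projection [IsProbabilityMeasure μ] (h : IsSpikedSample μ hd ν σ K z ξ)
    (U : Matrix (Fin d) (Fin r) ℝ) (a : Fin d → ℝ) (k : Fin n) :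
    ∫ ω, ((Uᵀ *ᵥ a) ⬝ᵥ z k ω + a ⬝ᵥ ξ k ω) ∂μ = 0 := by
  rw [integral_add (h.subG_z k _).integrable (h.subG_noise k _).integrable]
  simp only [dotProduct]
  rw [integral_finsetSum _ fun i _ =>
      ((memLp_coord (h.subG_z k) i).integrable one_le_two).const_mul _,
    integral_finsetSum _ fun i _ =>
      ((memLp_coord (h.subG_noise k) i).integrable one_le_two).const_mul _]
  simp [integral_const_mul, h.mean_z, h.mean_noise]

theorem variance_projection [IsProbabilityMeasure μ] (h : IsSpikedSample μ hd ν σ K z ξ)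
    (U : Matrix (Fin d) (Fin r) ℝ) (a : Fin d → ℝ) (k : Fin n) :
    variance (fun ω => (Uᵀ *ᵥ a) ⬝ᵥ z k ω + a ⬝ᵥ ξ k ω) μ
      = ν ^ 2 * ((Uᵀ *ᵥ a) ⬝ᵥ (Uᵀ *ᵥ a)) + ∑ i, σ i ^ 2 * a i ^ 2 := by
  have hind : IndepFun (fun ω => (Uᵀ *ᵥ a) ⬝ᵥ z k ω) (fun ω => a ⬝ᵥ ξ k ω) μ :=
    (h.indep k).comp (φ := fun x => (Uᵀ *ᵥ a) ⬝ᵥ x) (ψ := fun x => a ⬝ᵥ x)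
      (by unfold dotProduct; fun_prop) (by unfold dotProduct; fun_prop)
  rw [IndepFun.variance_fun_add ((h.subG_z k _).memLp 2) ((h.subG_noise k _).memLp 2) hind,
    variance_dotProduct (memLp_coord (h.subG_noise k)) (h.cov_noise k),
    variance_dotProduct (v := fun _ => ν ^ 2) (memLp_coord (h.subG_z k))
      (by rw [h.cov_z k, Matrix.smul_one_eq_diagonal])]
  simp [dotProduct, Finset.mul_sum, pow_two]

end IsSpikedSample

end Sample

theorem transpose_mulVec_dotProduct_self_le {d r : ℕ} {U : Matrix (Fin d) (Fin r) ℝ}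
    (hU : U ∈ Orthonormals d r) (a : Fin d → ℝ) : (Uᵀ *ᵥ a) ⬝ᵥ (Uᵀ *ᵥ a) ≤ a ⬝ᵥ a := by
  have hU' : Uᵀ * U = 1 := hU
  have h1 : a ⬝ᵥ (U *ᵥ (Uᵀ *ᵥ a)) = (Uᵀ *ᵥ a) ⬝ᵥ (Uᵀ *ᵥ a) := by
    rw [Matrix.dotProduct_mulVec a, ← Matrix.mulVec_transpose]
  have h2 : (U *ᵥ (Uᵀ *ᵥ a)) ⬝ᵥ (U *ᵥ (Uᵀ *ᵥ a)) = (Uᵀ *ᵥ a) ⬝ᵥ (Uᵀ *ᵥ a) := by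
    rw [Matrix.dotProduct_mulVec (U *ᵥ (Uᵀ *ᵥ a)), ← Matrix.mulVec_transpose,
      Matrix.mulVec_mulVec, hU', Matrix.one_mulVec]
  have h3 : 0 ≤ (a - U *ᵥ (Uᵀ *ᵥ a)) ⬝ᵥ (a - U *ᵥ (Uᵀ *ᵥ a)) :=
    Finset.sum_nonneg fun i _ => mul_self_nonneg _
  rw [sub_dotProduct, dotProduct_sub, dotProduct_sub, h2,
    dotProduct_comm (U *ᵥ (Uᵀ *ᵥ a)) a, h1] at h3
  linarith

/-! ### Moments of the scatter matrix and of the operator norm -/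

namespace IsSpikedSample

variable {Ω : Type*} [MeasurableSpace Ω] {μ : Measure Ω} {r d n : ℕ}
  {hd : 0 < d} {ν : ℝ} {σ : Fin d → ℝ} {K : ℝ≥0} {z : Fin n → Ω → Fin r → ℝ}
  {ξ : Fin n → Ω → Fin d → ℝ}

/-- The expected quadratic form of the scatter matrix is `n - 1` times that of the covariance. -/
theorem integral_quadForm_scatter [IsProbabilityMeasure μ]
    (h : IsSpikedSample μ hd ν σ K z ξ) (hn : n ≠ 0)
    (U : Matrix (Fin d) (Fin r) ℝ) (a : Fin d → ℝ) :
    Integrable (fun ω => a ⬝ᵥ (scatter (dataMatrix U (fun k => z k ω) fun k => ξ k ω) *ᵥ a)) μ ∧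
    ∫ ω, a ⬝ᵥ (scatter (dataMatrix U (fun k => z k ω) fun k => ξ k ω) *ᵥ a) ∂μ
      = ((n : ℝ) - 1) * (ν ^ 2 * ((Uᵀ *ᵥ a) ⬝ᵥ (Uᵀ *ᵥ a)) + ∑ i, σ i ^ 2 * a i ^ 2) := by
  simp only [quadForm_scatter, transpose_dataMatrix_mulVec]
  have hL := fun k => (h.subG_projection U a k).memLp 2
  have hm := h.integral_projection U a
  have hv := h.variance_projection U a
  have hi := h.iIndepFun_projection U a
  set p : Fin n → Ω → ℝ := fun k ω => (Uᵀ *ᵥ a) ⬝ᵥ z k ω + a ⬝ᵥ ξ k ω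
  set v := ν ^ 2 * ((Uᵀ *ᵥ a) ⬝ᵥ (Uᵀ *ᵥ a)) + ∑ i, σ i ^ 2 * a i ^ 2
  have hL' : ∀ k, MemLp (p k) 2 μ := hL
  have hsq : ∀ k, ∫ ω, p k ω ^ 2 ∂μ = v := fun k => by
    rw [← hv k, variance_of_integral_eq_zero (hL' k).aemeasurable (hm k)]
  have hLs : MemLp (fun ω => ∑ k, p k ω) 2 μ := memLp_finsetSum _ fun k _ => hL' k
  have hms : ∫ ω, ∑ k, p k ω ∂μ = 0 := by
    rw [integral_finsetSum _ fun k _ => (hL' k).integrable one_le_two]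
    exact Finset.sum_eq_zero fun k _ => hm k
  -- By independence the square of the sum has mean `n v`. Divided by `n` it removes one copy of
  -- `v`, hence the factor `n - 1`.
  have hsum : ∫ ω, (∑ k, p k ω) ^ 2 ∂μ = n * v := by
    rw [← variance_of_integral_eq_zero hLs.aemeasurable hms]
    have := IndepFun.variance_sum (s := Finset.univ) (fun k _ => hL' k)
      (fun i _ j _ hij => hi.indepFun hij)
    have e : (∑ k, p k) = fun ω => ∑ k, p k ω := by ext ω; simp
    rw [e] at this
    rw [this, Finset.sum_congr rfl fun k _ => hv k]
    simp
  have hI1 : Integrable (fun ω => ∑ k, p k ω ^ 2) μ :=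
    integrable_finsetSum _ fun k _ => (hL' k).integrable_sq
  have hI2 : Integrable (fun ω => (∑ k, p k ω) ^ 2 / n) μ := hLs.integrable_sq.div_const _
  refine ⟨hI1.sub hI2, ?_⟩
  rw [integral_sub hI1 hI2, integral_div, hsum,
    integral_finsetSum _ fun k _ => (hL' k).integrable_sq]
  have hn' : (n : ℝ) ≠ 0 := Nat.cast_ne_zero.2 hn
  simp only [hsq, Finset.sum_const, Finset.card_univ, Fintype.card_fin, nsmul_eq_mul]
  field_simp

/-- The constant is `32 = (4 + 4) · 4`: signal and noise of each sample contribute `4` each, and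
independence across samples brings the factor `∑ b k ^ 2 ≤ 4`. -/
theorem subG_bilinear (h : IsSpikedSample μ hd ν σ K z ξ) {U : Matrix (Fin d) (Fin r) ℝ}
    (hU : U ∈ Orthonormals d r) (hν : ν ^ 2 ≤ maxVar hd σ) {a : Fin d → ℝ} (ha : a ⬝ᵥ a ≤ 4)
    {b : Fin n → ℝ} (hb : b ⬝ᵥ b ≤ 4) :
    HasSubgaussianMGF
      (fun ω => b ⬝ᵥ ((dataMatrix U (fun k => z k ω) fun k => ξ k ω)ᵀ *ᵥ a))
      (32 * K * Real.toNNReal (maxVar hd σ)) μ := by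
  simp only [dotProduct, transpose_dataMatrix_mulVec]
  have hs : ∀ k, HasSubgaussianMGF (fun ω => (Uᵀ *ᵥ a) ⬝ᵥ z k ω + a ⬝ᵥ ξ k ω)
      (8 * K * Real.toNNReal (maxVar hd σ)) μ := by
    refine fun k => hasSubgaussianMGF_mono (h.subG_projection U a k) ?_
    have h4 : Real.toNNReal (a ⬝ᵥ a) ≤ 4 := by simpa using Real.toNNReal_le_toNNReal ha
    have h4' : Real.toNNReal ((Uᵀ *ᵥ a) ⬝ᵥ (Uᵀ *ᵥ a)) ≤ 4 :=
      (Real.toNNReal_le_toNNReal (transpose_mulVec_dotProduct_self_le hU a)).trans h4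
    calc _ ≤ K * Real.toNNReal (maxVar hd σ) * 4 + K * Real.toNNReal (maxVar hd σ) * 4 := by
          gcongr
      _ = _ := by ring
  have hi := (h.iIndepFun_projection U a).comp (fun k x => b k * x) (fun k => by fun_prop)
  refine hasSubgaussianMGF_mono (HasSubgaussianMGF.sum_of_iIndepFun (s := Finset.univ) hi
    fun k _ => hasSubgaussianMGF_const_mul (hs k) (b k)) ?_
  rw [← Finset.sum_mul]
  have : ∑ k, Real.toNNReal (b k ^ 2) ≤ 4 := by
    rw [← Real.toNNReal_sum_of_nonneg fun _ _ => sq_nonneg _]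
    simpa [dotProduct, pow_two] using Real.toNNReal_le_toNNReal hb
  calc _ ≤ 4 * (8 * K * Real.toNNReal (maxVar hd σ)) := by gcongr
    _ = _ := by ring

/-- The operator norm of the data matrix is of order `√n`, in fourth moment. -/
theorem exists_opNorm_pow_four_le [IsProbabilityMeasure μ] (h : IsSpikedSample μ hd ν σ K z ξ)
    {U : Matrix (Fin d) (Fin r) ℝ} (hU : U ∈ Orthonormals d r) (hm : 0 < maxVar hd σ)
    (hν : ν ^ 2 ≤ maxVar hd σ) (hdn : d < n) :
    ∃ G : Ω → ℝ, Integrable G μ ∧ ∫ ω, G ω ∂μ ≤ 2 * (25 * Real.exp (16 * K)) ∧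
      ∀ ω, ∃ ℓ : ℝ, 0 ≤ ℓ ∧
        (∀ v, ((dataMatrix U (fun k => z k ω) fun k => ξ k ω)ᵀ *ᵥ v) ⬝ᵥ
          ((dataMatrix U (fun k => z k ω) fun k => ξ k ω)ᵀ *ᵥ v) ≤ ℓ ^ 2 * (v ⬝ᵥ v)) ∧
        ℓ ^ 4 ≤ 24 * (maxVar hd σ * n) ^ 2 * G ω := by
  obtain ⟨N, N', hN, hN', hN4, hN4', hnet⟩ := exists_bilinear_nets d n
  set m := maxVar hd σ with hmdef
  set A := 25 * Real.exp (16 * K) with hA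
  have hn : (0 : ℝ) < n := Nat.cast_pos.2 (by omega)
  have hA1 : 0 < A := by positivity
  -- With this `t` each exponential moment is at most `exp (16 K n)`. There are at most `25 ^ n`
  -- pairs in the nets, which explains `A`.
  set t := Real.sqrt (n / m) with ht
  have ht2 : t ^ 2 = n / m := Real.sq_sqrt (by positivity)
  have ht0 : 0 ≤ t := Real.sqrt_nonneg _
  let Z : Ω → ℝ := fun ω => ∑ a ∈ N, ∑ b ∈ N',
    Real.exp (t * (b ⬝ᵥ ((dataMatrix U (fun k => z k ω) fun k => ξ k ω)ᵀ *ᵥ a)))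
  have hint : ∀ a ∈ N, ∀ b ∈ N', Integrable (fun ω =>
      Real.exp (t * (b ⬝ᵥ ((dataMatrix U (fun k => z k ω) fun k => ξ k ω)ᵀ *ᵥ a)))) μ :=
    fun a ha b hb => (h.subG_bilinear hU hν (hN4 a ha) (hN4' b hb)).integrable_exp_mul t
  have hZi : Integrable Z μ :=
    integrable_finsetSum _ fun a ha => integrable_finsetSum _ fun b hb => hint a ha b hb
  have hZ0 : ∀ ω, 0 ≤ Z ω := fun ω =>
    Finset.sum_nonneg fun _ _ => Finset.sum_nonneg fun _ _ => (Real.exp_pos _).le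
  have hEZ : ∫ ω, Z ω ∂μ ≤ A ^ n := by
    have h1 : ∫ ω, Z ω ∂μ = ∑ a ∈ N, ∑ b ∈ N', ∫ ω,
        Real.exp (t * (b ⬝ᵥ ((dataMatrix U (fun k => z k ω) fun k => ξ k ω)ᵀ *ᵥ a))) ∂μ := by
      rw [integral_finsetSum _ fun a ha => integrable_finsetSum _ fun b hb => hint a ha b hb]
      exact Finset.sum_congr rfl fun a ha => integral_finsetSum _ fun b hb => hint a ha b hb
    have h2 : ∀ a ∈ N, ∀ b ∈ N', ∫ ω,
        Real.exp (t * (b ⬝ᵥ ((dataMatrix U (fun k => z k ω) fun k => ξ k ω)ᵀ *ᵥ a))) ∂μ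
          ≤ Real.exp (16 * K) ^ n := by
      intro a ha b hb
      refine ((h.subG_bilinear hU hν (hN4 a ha) (hN4' b hb)).mgf_le t).trans_eq ?_
      rw [← Real.exp_nat_mul, ht2]
      congr 1
      push_cast
      rw [Real.coe_toNNReal _ hm.le]
      field_simp
      ring
    calc ∫ ω, Z ω ∂μ ≤ ∑ a ∈ N, ∑ b ∈ N', Real.exp (16 * K) ^ n := by
          rw [h1]
          exact Finset.sum_le_sum fun a ha => Finset.sum_le_sum fun b hb => h2 a ha b hb
      _ = (N.card : ℝ) * N'.card * Real.exp (16 * K) ^ n := by simp [mul_assoc]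
      _ ≤ 5 ^ n * 5 ^ n * Real.exp (16 * K) ^ n := by
          have : (N.card : ℝ) ≤ 5 ^ n := by
            exact_mod_cast hN.trans (Nat.pow_le_pow_right (by norm_num) hdn.le)
          have : (N'.card : ℝ) ≤ 5 ^ n := by exact_mod_cast hN'
          gcongr
      _ = A ^ n := by rw [hA, ← mul_pow, ← mul_pow]; norm_num
  refine ⟨fun ω => A * (1 + Z ω / A ^ n), ?_, ?_, fun ω => ?_⟩
  · exact ((integrable_const _).add (hZi.div_const _)).const_mul _
  · rw [integral_const_mul, integral_add (integrable_const _) (hZi.div_const _), integral_div]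
    have : (∫ ω, Z ω ∂μ) / A ^ n ≤ 1 := (div_le_one (by positivity)).2 hEZ
    simp only [integral_const, probReal_univ, smul_eq_mul, mul_one]
    nlinarith
  · obtain ⟨ℓ, hℓ, hv, a, ha, b, hb, hab⟩ := hnet (dataMatrix U (fun k => z k ω) fun k => ξ k ω)
    refine ⟨ℓ, hℓ, hv, ?_⟩
    set u := t * ℓ / n with hu
    have hu0 : 0 ≤ u := by positivity
    have hpow : Real.exp u ^ n ≤ Z ω := by
      rw [← Real.exp_nat_mul, hu, mul_div_cancel₀ _ hn.ne']
      refine (Real.exp_le_exp.2 (mul_le_mul_of_nonneg_left hab ht0)).trans ?_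
      refine le_trans ?_ (Finset.single_le_sum (f := fun a => ∑ b ∈ N', Real.exp (t *
        (b ⬝ᵥ ((dataMatrix U (fun k => z k ω) fun k => ξ k ω)ᵀ *ᵥ a))))
        (fun _ _ => Finset.sum_nonneg fun _ _ => (Real.exp_pos _).le) ha)
      exact Finset.single_le_sum (f := fun b => Real.exp (t *
        (b ⬝ᵥ ((dataMatrix U (fun k => z k ω) fun k => ξ k ω)ᵀ *ᵥ a))))
        (fun _ _ => (Real.exp_pos _).le) hb
    -- Above the level `A`, the ratio `exp u / A` is at least `1`, hence at most its `n`-th power,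
    -- which `Z / A ^ n` dominates. The mean of the latter is at most `1`.
    have hexp : Real.exp u ≤ A * (1 + Z ω / A ^ n) := by
      have hq : 0 ≤ Z ω / A ^ n := div_nonneg (hZ0 ω) (by positivity)
      rcases le_total (Real.exp u) A with hle | hle
      · nlinarith
      · have h1 : 1 ≤ Real.exp u / A := (one_le_div hA1).2 hle
        have h2 : Real.exp u / A ≤ (Real.exp u / A) ^ n := le_self_pow₀ h1 (by omega)
        rw [div_pow] at h2
        have h3 : Real.exp u / A ≤ Z ω / A ^ n :=
          h2.trans (div_le_div_of_nonneg_right hpow (by positivity))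
        rw [div_le_iff₀ hA1] at h3
        nlinarith
    have h24 : u ^ 4 / 24 ≤ Real.exp u := by
      simpa [Nat.factorial] using Real.pow_div_factorial_le_exp u hu0 4
    have hu4 : ℓ ^ 4 = (m * n) ^ 2 * u ^ 4 := by
      have : t ^ 4 = (n / m) ^ 2 := by rw [← ht2]; ring
      rw [hu, div_pow, mul_pow t ℓ, this]
      field_simp
    rw [hu4]
    have h5 : 0 ≤ (m * n) ^ 2 := sq_nonneg _
    nlinarith [mul_le_mul_of_nonneg_left (h24.trans hexp) h5]

end IsSpikedSample

/-! ### The energy deficit in expectation -/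

theorem sortedDesc_strictAnti {d : ℕ} {f : Fin d → ℝ} (hf : Function.Injective f) :
    StrictAnti (sortedDesc f) :=
  (sortedDesc_antitone f).strictAnti_of_injective
    (hf.comp ((Tuple.sort f).injective.comp Fin.rev_injective))

theorem row_sq_le_incoherence {d r : ℕ} (U : Matrix (Fin d) (Fin r) ℝ) (i : Fin d) :
    ∑ j, U i j ^ 2 ≤ incoherence U :=
  le_ciSup (f := fun i => ∑ j, U i j ^ 2) (Set.finite_range _).bddAbove i

/-- The covariance energy of an incoherent subspace falls short of that of the coordinate vectors
with the `r` largest noise variances. -/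
theorem energy_add_gap_le {d r : ℕ} (hr : 0 < r) (hrd : r < d) (hr' : r - 1 < d)
    {U : Matrix (Fin d) (Fin r) ℝ} (hU : U ∈ Orthonormals d r) (hI : incoherence U ≤ 1 / 2)
    (ν : ℝ) (σ : Fin d → ℝ) :
    ∑ j, (ν ^ 2 * ((Uᵀ *ᵥ U.col j) ⬝ᵥ (Uᵀ *ᵥ U.col j)) + ∑ i, σ i ^ 2 * U.col j i ^ 2)
      + (r / 2 * (sortedDesc (fun i => σ i ^ 2) ⟨r - 1, hr'⟩
          - sortedDesc (fun i => σ i ^ 2) ⟨r, hrd⟩) - ν ^ 2 * r)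
      ≤ ∑ j : Fin r, sortedDesc (fun i => σ i ^ 2) (Fin.castLE hrd.le j) := by
  have hU' : Uᵀ * U = 1 := hU
  have h1 : ∀ j, (Uᵀ *ᵥ U.col j) ⬝ᵥ (Uᵀ *ᵥ U.col j) = 1 := by
    intro j
    have : Uᵀ *ᵥ U.col j = Pi.single j 1 := by
      rw [← Matrix.mulVec_single_one U j, Matrix.mulVec_mulVec, hU', Matrix.one_mulVec]
    simp [this]
  -- The weights are the squared row norms of `U`; incoherence caps them at `ε = 1/2`, which gives
  -- half the gap per dimension.
  have h2 := sum_mul_add_gap_le_sum_sortedDesc hr hrd hr' (fun i => σ i ^ 2)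
    (fun i => ∑ j, U i j ^ 2) (ε := 1 / 2) (by norm_num)
    (fun i => Finset.sum_nonneg fun j _ => sq_nonneg _)
    (fun i => (row_sq_le_incoherence U i).trans hI)
    (by
      rw [Finset.sum_comm]
      simp [sum_sq_eq_one_of_transpose_mul hU'])
  have h3 : ∑ j, ∑ i, σ i ^ 2 * U.col j i ^ 2 = ∑ i, (∑ j, U i j ^ 2) * σ i ^ 2 := by
    rw [Finset.sum_comm]
    refine Finset.sum_congr rfl fun i _ => ?_
    rw [Finset.sum_mul]
    exact Finset.sum_congr rfl fun j _ => mul_comm _ _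
  simp only [Finset.sum_add_distrib, h1, h3, mul_one, Finset.sum_const, Finset.card_univ,
    Fintype.card_fin, nsmul_eq_mul]
  linarith

/-- The expected energy deficit of `U₁` is controlled by the expected sine distance. -/
theorem energy_deficit_le {r d n : ℕ} (hr : 0 < r) (hrd : r < d) (hr' : r - 1 < d) (hd : 0 < d)
    (hdn : d < n)
    {U₁ : Matrix (Fin d) (Fin r) ℝ} (hU : U₁ ∈ Orthonormals d r)
    (hI : incoherence U₁ ≤ 1 / 2) {ν : ℝ} {σ : Fin d → ℝ} {K : ℝ≥0}
    (hm : 0 < maxVar hd σ) (hν : ν ^ 2 ≤ maxVar hd σ)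
    {Ω : Type*} [MeasurableSpace Ω] {μ : Measure Ω} [IsProbabilityMeasure μ]
    {z : Fin n → Ω → Fin r → ℝ} {ξ : Fin n → Ω → Fin d → ℝ}
    (h : IsSpikedSample μ hd ν σ K z ξ) {U : Ω → Matrix (Fin d) (Fin r) ℝ}
    (hUm : ∀ i j, AEMeasurable (fun ω => U ω i j) μ)
    (hUtop : ∀ᵐ ω ∂μ, IsTopEigenvectors hrd.le
      (scatter_isHermitian (dataMatrix U₁ (fun k => z k ω) fun k => ξ k ω)) (U ω))
    {θ : ℝ} (hθ : 0 < θ) :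
    ((n : ℝ) - 1) * (r / 2 * (sortedDesc (fun i => σ i ^ 2) ⟨r - 1, hr'⟩
          - sortedDesc (fun i => σ i ^ 2) ⟨r, hrd⟩) - ν ^ 2 * r)
      ≤ 3 / 2 * Real.sqrt r * (maxVar hd σ * n) *
        (48 * (25 * Real.exp (16 * K)) * θ * Real.sqrt r + (∫ ω, sinTheta U₁ (U ω) ∂μ) / θ) := by
  obtain ⟨G, hGi, hEG, hG⟩ := h.exists_opNorm_pow_four_le hU hm hν hdn
  set m := maxVar hd σ with hmdef
  set A := 25 * Real.exp (16 * K) with hA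
  have hn0 : n ≠ 0 := by omega
  have hn : (0 : ℝ) < n := Nat.cast_pos.2 (by omega)
  have hn1 : (0 : ℝ) ≤ n - 1 := sub_nonneg.2 (by exact_mod_cast (by omega : 1 ≤ n))
  have hr0 : (0 : ℝ) < Real.sqrt r := Real.sqrt_pos.2 (Nat.cast_pos.2 hr)
  have hsi : Integrable (fun ω => sinTheta U₁ (U ω)) μ := by
    refine Integrable.of_mem_Icc 0 (Real.sqrt r) ?_ ?_
    · unfold sinTheta frobNorm
      simp only [Matrix.mul_apply]
      fun_prop
    · filter_upwards [hUtop] with ω hω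
      exact ⟨sinTheta_nonneg _ _, sinTheta_le hU hω.orthonormal⟩
  let T : Fin r → Fin d := fun j => Tuple.sort (fun i => σ i ^ 2) (Fin.castLE hrd.le j).rev
  have hT : Function.Injective T :=
    (Tuple.sort _).injective.comp (Fin.rev_injective.comp (Fin.castLE_injective hrd.le))
  set S : Ω → Matrix (Fin d) (Fin d) ℝ := fun ω =>
    scatter (dataMatrix U₁ (fun k => z k ω) fun k => ξ k ω) with hS
  have hpt : ∀ᵐ ω ∂μ,
      ∑ j, Pi.single (T j) 1 ⬝ᵥ (S ω *ᵥ Pi.single (T j) 1) ≤ ∑ j, U₁.col j ⬝ᵥ (S ω *ᵥ U₁.col j)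
        + 3 / 2 * Real.sqrt r * (m * n) * (24 * θ * Real.sqrt r * G ω + sinTheta U₁ (U ω) / θ) := by
    filter_upwards [hUtop] with ω hω
    obtain ⟨ℓ, hℓ, hX, hℓ4⟩ := hG ω
    have h1 := hω.sum_diag_scatter_le hr hrd hn0 hU T hT hℓ hX
    have hs0 := sinTheta_nonneg U₁ (U ω)
    have hsr := sinTheta_le hU hω.orthonormal
    generalize sinTheta U₁ (U ω) = s at *
    -- AM-GM with weight `θ √r / (m n)` trades `ℓ² s` for `ℓ⁴`, whose mean is controlled, and `s²`,
    -- which is linearized by `s ≤ √r`.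
    have h2 : 2 * (ℓ ^ 2 * s) ≤ (m * n) * (24 * θ * Real.sqrt r * G ω + s / θ) := by
      have hmn : 0 < m * n := mul_pos hm hn
      have h3 : 2 * (ℓ ^ 2 * s) ≤ θ * Real.sqrt r / (m * n) * ℓ ^ 4
          + (m * n) / (θ * Real.sqrt r) * s ^ 2 := by
        have hc : 0 < θ * Real.sqrt r / (m * n) := by positivity
        have e : θ * Real.sqrt r / (m * n) * ℓ ^ 4 + (m * n) / (θ * Real.sqrt r) * s ^ 2
            - 2 * (ℓ ^ 2 * s) = θ * Real.sqrt r / (m * n)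
              * (ℓ ^ 2 - (m * n) / (θ * Real.sqrt r) * s) ^ 2 := by
          field_simp
          ring
        have := mul_nonneg hc.le (sq_nonneg (ℓ ^ 2 - (m * n) / (θ * Real.sqrt r) * s))
        linarith
      have h4 : θ * Real.sqrt r / (m * n) * ℓ ^ 4 ≤ (m * n) * (24 * θ * Real.sqrt r * G ω) := by
        calc _ ≤ θ * Real.sqrt r / (m * n) * (24 * (m * n) ^ 2 * G ω) := by gcongr
          _ = _ := by field_simp
      have h5 : (m * n) / (θ * Real.sqrt r) * s ^ 2 ≤ (m * n) * (s / θ) := by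
        calc _ ≤ (m * n) / (θ * Real.sqrt r) * (s * Real.sqrt r) := by
              rw [pow_two]
              gcongr
          _ = _ := by field_simp
      linarith
    have h6 := mul_le_mul_of_nonneg_left h2 (by positivity : 0 ≤ 3 / 2 * Real.sqrt r)
    have h7 : ∀ i, Pi.single i 1 ⬝ᵥ (S ω *ᵥ Pi.single i 1) = S ω i i := by
      intro i
      simp
    simp only [h7]
    refine h1.trans ?_
    linarith
  have hQ := fun a => h.integral_quadForm_scatter hn0 U₁ a
  have hI1 : Integrable (fun ω => ∑ j, Pi.single (T j) 1 ⬝ᵥ (S ω *ᵥ Pi.single (T j) 1)) μ :=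
    integrable_finsetSum _ fun j _ => (hQ _).1
  have hI2 : Integrable (fun ω => ∑ j, U₁.col j ⬝ᵥ (S ω *ᵥ U₁.col j)) μ :=
    integrable_finsetSum _ fun j _ => (hQ _).1
  have hI3 : Integrable (fun ω => 24 * θ * Real.sqrt r * G ω + sinTheta U₁ (U ω) / θ) μ :=
    (hGi.const_mul _).add (hsi.div_const _)
  have hE := integral_mono_ae hI1 (hI2.add (hI3.const_mul _)) hpt
  simp only [Pi.add_apply] at hE
  rw [integral_add hI2 (hI3.const_mul _), integral_const_mul,
    integral_add (hGi.const_mul _) (hsi.div_const _), integral_const_mul, integral_div,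
    integral_finsetSum _ fun j _ => (hQ _).1, integral_finsetSum _ fun j _ => (hQ _).1] at hE
  rw [Finset.sum_congr rfl fun j _ => (hQ (Pi.single (T j) 1)).2,
    Finset.sum_congr rfl fun j _ => (hQ (U₁.col j)).2, ← Finset.mul_sum, ← Finset.mul_sum] at hE
  -- The signal energy of the coordinate vectors is nonnegative and is dropped.
  have hlow : ∑ j : Fin r, sortedDesc (fun i => σ i ^ 2) (Fin.castLE hrd.le j)
      ≤ ∑ j, (ν ^ 2 * ((U₁ᵀ *ᵥ Pi.single (T j) 1) ⬝ᵥ (U₁ᵀ *ᵥ Pi.single (T j) 1))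
        + ∑ i, σ i ^ 2 * (Pi.single (T j) 1 : Fin d → ℝ) i ^ 2) := by
    refine Finset.sum_le_sum fun j _ => ?_
    have e : ∑ i, σ i ^ 2 * (Pi.single (T j) 1 : Fin d → ℝ) i ^ 2 = σ (T j) ^ 2 := by
      rw [Finset.sum_eq_single (T j) (fun i _ hi => by simp [hi]) (by simp)]
      simp
    rw [e]
    have : 0 ≤ (U₁ᵀ *ᵥ Pi.single (T j) 1) ⬝ᵥ (U₁ᵀ *ᵥ Pi.single (T j) 1) :=
      Finset.sum_nonneg fun _ _ => mul_self_nonneg _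
    exact le_add_of_nonneg_left (mul_nonneg (sq_nonneg _) this)
  have hgap := mul_le_mul_of_nonneg_left
    ((energy_add_gap_le hr hrd hr' hU hI ν σ).trans hlow) hn1
  rw [mul_add] at hgap
  have hGm : 24 * θ * Real.sqrt r * ∫ ω, G ω ∂μ ≤ 48 * A * θ * Real.sqrt r := by
    calc _ ≤ 24 * θ * Real.sqrt r * (2 * A) := by gcongr
      _ = _ := by ring
  have hlast := mul_le_mul_of_nonneg_left (add_le_add_left hGm
    ((∫ ω, sinTheta U₁ (U ω) ∂μ) / θ)) (by positivity : 0 ≤ 3 / 2 * Real.sqrt r * (m * n))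
  linarith

end SpikedPCA

/-! ### Choice of the constants -/

theorem theorem3p1 (C Cσ CI : ℝ) (K : ℝ≥0) :
    ∃ Cρ > (0 : ℝ), ∃ c ∈ Set.Ioo (0 : ℝ) 1, ∃ D₀ > (0 : ℝ),
      ∀ (r d n : ℕ) (hr : 0 < r) (hrd : r < d) (_ : d < n)
        (_ : D₀ * (r * Real.log d) ≤ d)
        (Ustar : Matrix (Fin d) (Fin r) ℝ) (_ : Ustar ∈ Orthonormals d r)
        (_ : incoherence Ustar ≤ CI * (r * Real.log d / d))
        (ν : ℝ) (_ : 0 < ν)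
        (σ : Fin d → ℝ) (_ : ∀ i, 0 < σ i)
        (_ : Function.Injective fun i => σ i ^ 2)
        (_ : maxVar (hr.trans hrd) σ
              / sortedDesc (fun i => σ i ^ 2) ⟨d - 1, by omega⟩ < C)
        (_ : maxVar (hr.trans hrd) σ
              / (sortedDesc (fun i => σ i ^ 2) ⟨r - 1, by omega⟩
                  - sortedDesc (fun i => σ i ^ 2) ⟨r, hrd⟩) < Cσ)
        (_ : snr (hr.trans hrd) ν σ < Cρ)
        {Ω : Type*} [MeasurableSpace Ω] (μ : Measure Ω) [IsProbabilityMeasure μ]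
        (z : Fin n → Ω → Fin r → ℝ) (ξ : Fin n → Ω → Fin d → ℝ)
        (_ : IsSpikedSample μ (hr.trans hrd) ν σ K z ξ)
        (W : Ω → Matrix (Fin r) (Fin d) ℝ) (U : Ω → Matrix (Fin d) (Fin r) ℝ)
        (S V : Ω → Matrix (Fin r) (Fin r) ℝ)
        (_ : ∀ i j, AEMeasurable (fun ω => U ω i j) μ)
        (_ : ∀ᵐ ω ∂μ, IsAutoencoder hrd.le
              (dataMatrix Ustar (fun k => z k ω) (fun k => ξ k ω)) (W ω) (U ω) (S ω) (V ω)),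
        c * Real.sqrt r ≤ ∫ ω, sinTheta Ustar (U ω) ∂μ := by

  set C₁ := max Cσ 1 with hC₁
  set A := 25 * Real.exp (16 * K) with hA
  have hC1 : 1 ≤ C₁ := le_max_right _ _
  have hC0 : 0 < C₁ := by linarith
  have hA1 : 25 ≤ A := by
    have : 1 ≤ Real.exp (16 * (K : ℝ)) := Real.one_le_exp (by positivity)
    linarith
  have hA0 : 0 < A := by linarith
  have hCI : 0 < max CI 1 := lt_max_of_lt_right one_pos
  -- Chosen so that the operator norm term `48 A θ √r` equals `√r / (24 C₁)`, half of the normalized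
  -- deficit `√r / (12 C₁)`.
  set θ := 1 / (48 * 24 * A * C₁) with hθ
  have hθ0 : 0 < θ := by positivity
  have hθ1 : θ ≤ 1 := by
    rw [hθ, div_le_one (by positivity)]
    nlinarith [mul_le_mul hA1 hC1 zero_le_one hA0.le]
  -- `Cρ` makes `r ν²` at most half of the lower bound `r m / (2 C₁)` on the noise deficit, where
  -- `m` is the largest variance. `D₀` brings the incoherence below `1/2`.
  refine ⟨1 / (2 * C₁), by positivity, θ / (24 * C₁), ⟨by positivity, ?_⟩, 2 * max CI 1,
    by positivity, ?_⟩
  · rw [div_lt_one (by positivity)]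
    linarith
  intro r d n hr hrd hdn hD Ustar hU hinc ν hν σ hσ hinj _ hgap hsnr Ω _ μ _ z ξ h W U S V hUm hAE
  have hd0 : (0 : ℝ) < d := Nat.cast_pos.2 (hr.trans hrd)
  have hr0 : (0 : ℝ) < Real.sqrt r := Real.sqrt_pos.2 (Nat.cast_pos.2 hr)
  have hrr : Real.sqrt r * Real.sqrt r = r := Real.mul_self_sqrt (Nat.cast_nonneg r)
  have hm := maxVar_pos (hr.trans hrd) hσ
  have hn2 : (2 : ℝ) ≤ n := by exact_mod_cast (by omega : 2 ≤ n)
  have hI : incoherence Ustar ≤ 1 / 2 := by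
    have hlog : 0 ≤ r * Real.log d / d := by positivity
    refine hinc.trans ((mul_le_mul_of_nonneg_right (le_max_left CI 1) hlog).trans ?_)
    rw [← mul_div_assoc, div_le_iff₀ hd0]
    linarith
  have hν2 : ν ^ 2 ≤ maxVar (hr.trans hrd) σ / (4 * C₁) := by
    have hlt : ν < 1 / (2 * C₁) * Real.sqrt (maxVar (hr.trans hrd) σ) :=
      (div_lt_iff₀ (Real.sqrt_pos.2 hm)).1 hsnr
    have hsq := pow_le_pow_left₀ hν.le hlt.le 2
    rw [mul_pow, Real.sq_sqrt hm.le] at hsq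
    refine hsq.trans ?_
    have : (1 / (2 * C₁)) ^ 2 ≤ 1 / (4 * C₁) := by
      rw [div_pow, one_pow]
      exact one_div_le_one_div_of_le (by positivity) (by nlinarith)
    calc _ ≤ 1 / (4 * C₁) * maxVar (hr.trans hrd) σ := by gcongr
      _ = _ := by ring
  have hνm : ν ^ 2 ≤ maxVar (hr.trans hrd) σ :=
    hν2.trans (div_le_self hm.le (by linarith))
  have key := energy_deficit_le hr hrd (by omega) (hr.trans hrd) hdn hU hI hm hνm h hUm
    (hAE.mono fun ω hω => hω.top) hθ0
  -- Distinct variances matter here: with a zero gap the quotient in `hgap` would be `0` by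
  -- convention and would say nothing about the gap.
  have hpos : 0 < sortedDesc (fun i => σ i ^ 2) ⟨r - 1, by omega⟩
      - sortedDesc (fun i => σ i ^ 2) ⟨r, hrd⟩ :=
    sub_pos.2 (sortedDesc_strictAnti hinj (Fin.mk_lt_mk.2 (by omega)))
  have hδ : maxVar (hr.trans hrd) σ / C₁ ≤ sortedDesc (fun i => σ i ^ 2) ⟨r - 1, by omega⟩
      - sortedDesc (fun i => σ i ^ 2) ⟨r, hrd⟩ := by
    rw [div_le_iff₀ hC0, mul_comm, ← div_le_iff₀ hpos]
    exact hgap.le.trans (le_max_left _ _)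
  set m := maxVar (hr.trans hrd) σ
  set δ := sortedDesc (fun i => σ i ^ 2) ⟨r - 1, by omega⟩
      - sortedDesc (fun i => σ i ^ 2) ⟨r, hrd⟩
  set E := ∫ ω, sinTheta Ustar (U ω) ∂μ
  have hdef : r * (m / (4 * C₁)) ≤ r / 2 * δ - ν ^ 2 * r := by
    have h1 : (r : ℝ) / 2 * (m / C₁) ≤ r / 2 * δ := by gcongr
    have h2 : (r : ℝ) * ν ^ 2 ≤ r * (m / (4 * C₁)) := by gcongr
    have h3 : (r : ℝ) / 2 * (m / C₁) = 2 * (r * (m / (4 * C₁))) := by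
      field_simp
      ring
    linarith
  -- Uses `n - 1 ≥ n / 2`, valid since `n ≥ 2`.
  have hstart : (n : ℝ) / 2 * (r * (m / (4 * C₁))) ≤ ((n : ℝ) - 1) * (r / 2 * δ - ν ^ 2 * r) :=
    mul_le_mul (by linarith) hdef (by positivity) (by linarith)
  have hfac : 3 / 2 * Real.sqrt r * (m * n) * (Real.sqrt r / (12 * C₁))
      = (n : ℝ) / 2 * (r * (m / (4 * C₁))) := by
    calc _ = (n : ℝ) / 2 * (Real.sqrt r * Real.sqrt r * (m / (4 * C₁))) := by
          field_simp
          ring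
      _ = _ := by rw [hrr]
  have hmain : Real.sqrt r / (12 * C₁) ≤ 48 * A * θ * Real.sqrt r + E / θ :=
    le_of_mul_le_mul_left (hfac.trans_le (hstart.trans key)) (by positivity)
  have hAθ : 48 * A * θ * Real.sqrt r = Real.sqrt r / (24 * C₁) := by
    rw [hθ]
    field_simp
  have hhalf : Real.sqrt r / (12 * C₁) = 2 * (Real.sqrt r / (24 * C₁)) := by
    field_simp
    norm_num
  have hfin : Real.sqrt r / (24 * C₁) ≤ E / θ := by linarith
  rw [le_div_iff₀ hθ0] at hfin
  calc θ / (24 * C₁) * Real.sqrt r = Real.sqrt r / (24 * C₁) * θ := by ring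
    _ ≤ E := hfin
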